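/- Fix an integer $n\ge 1$ and let $L_n$ be the language with a single $n$-ary relation symbol $R$. For an $L_n$-structure $M$ and a finite subset $A\subseteq M$ put $\delta_n(A)=|A|-|R^A|$, where $R^A$ is the set of ordered $n$-tuples (repetitions allowed) of elements of $A$ that satisfy $R$. Let $\bar{\mathcal C}_n$ be the class of $L_n$-structures all of whose finite subsets $A$ satisfy $\delta_n(A)\ge 0$, and $\mathcal C_n$ the class of finite structures in $\bar{\mathcal C}_n$. For a finite $A\subseteq M\in\bar{\mathcal C}_n$ write $A\le M$ if $\delta_n(A)\le\delta_n(B)$ for all finite $B$ with $A\subseteq B\subseteq M$. Let $\mathcal M_n$ denote a generic structure for $(\mathcal C_n,\le)$, that is, a countable structure in $\bar{\mathcal C}_n$ such that whenever $A\le\mathcal M_n$ is finite and $A\le B\in\mathcal C_n$, there is an embedding $g:B\to\mathcal M_n$ with $g|_A=\mathrm{id}_A$ and $g(B)\le\mathcal M_n$. (Such a structure exists and is unique up to isomorphism.) For a finite $A\subseteq\mathcal M_n$ let $d(A)$ be the minimum of $\delta_n(A')$ over all finite $A'$ with $A\subseteq A'\subseteq\mathcal M_n$. Let $PG(\mathcal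 M_n)$ be the pregeometry on $\mathcal M_n$ whose closure operation sends a finite set $A$ to $\mathrm{cl}^d(A)=\{c\in\mathcal M_n : d(A\cup\{c\})=d(A)\}$ and an arbitrary set to the union of the closures of its finite subsets. For $Z\subseteq\mathcal M_n$ let $PG_Z(\mathcal M_n)$ be the localization, the pregeometry on the same set with closure operation $A\mapsto\mathrm{cl}^d(Z\cup A)$. An isomorphism of pregeometries is a bijection that respects the closure operations. **Theorem.** Let $m\ne n$ be positive integers. Then $PG(\mathcal M_m)$ and $PG(\mathcal M_n)$ are not locally isomorphic: there are no finite sets $Y\subseteq\mathcal M_m$ and $Z\subseteq\mathcal M_n$ such that $PG_Y(\mathcal M_m)$ and $PG_Z(\mathcal M_n)$ are isomorphic pregeometries. -/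

import Mathlib

/-! An `L_n`-structure (one `n`-ary relation symbol) with universe `M` is given by the interpretation
`R : Set (Fin n → M)` of the symbol. Relations are sets of ordered tuples, repetitions allowed. -/

namespace Predim

/-- `R^A`: the tuples of `R` all of whose entries lie in the finite set `A`. -/
def relsIn {n : ℕ} {M : Type*} (R : Set (Fin n → M)) (A : Finset M) : Set (Fin n → M) :=
  {t | t ∈ R ∧ ∀ i, t i ∈ A}

/-- The predimension `δ(A) = |A| - |R^A|` of the finite substructure with universe `A`
(the set `R^A` is finite). -/
noncomputable def predim {n : ℕ} {M : Type*} (R : Set (Fin n → M)) (A : Finset M) : ℤ :=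
  (A.card : ℤ) - ((relsIn R A).ncard : ℤ)

/-- All finite substructures have non-negative predimension. For finite `M` this says that
the structure lies in the class `𝒞_n`, for arbitrary `M` that it lies in `𝒞̄_n`. -/
def InClass {n : ℕ} {M : Type*} (R : Set (Fin n → M)) : Prop :=
  ∀ A : Finset M, 0 ≤ predim R A

/-- `A ≤ M`, for a finite subset `A` of a structure `M`. -/
def SelfSufficient {n : ℕ} {M : Type*} (R : Set (Fin n → M)) (A : Finset M) : Prop :=
  ∀ B : Finset M, A ⊆ B → predim R A ≤ predim R B

/-- `g` is an embedding of the structure `(A, S)` into the structure `(B, R)`. -/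
def IsEmb {n : ℕ} {A B : Type*} (S : Set (Fin n → A)) (R : Set (Fin n → B)) (g : A ↪ B) : Prop :=
  ∀ t : Fin n → A, (fun i => g (t i)) ∈ R ↔ t ∈ S

/-- The structure induced on a finite subset. -/
def induced {n : ℕ} {M : Type*} (R : Set (Fin n → M)) (A : Finset M) : Set (Fin n → A) :=
  {t | (fun i => (t i : M)) ∈ R}

/-- `(M, R)` is a generic structure for `(𝒞_n, ≤)`: it is countable, it lies in `𝒞̄_n`, and
for all finite `A ≤ M` and every `B ∈ 𝒞_n` of which `A` is (via `j`) a self-sufficient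
substructure, there is an embedding of `B` in `M` over `A` with self-sufficient image. -/
structure IsGeneric {n : ℕ} {M : Type*} (R : Set (Fin n → M)) : Prop where
  countable : Countable M
  inClass : InClass R
  extension : ∀ A : Finset M, SelfSufficient R A →
    ∀ (B : Type) [Fintype B] (S : Set (Fin n → B)), InClass S →
    ∀ j : A ↪ B, IsEmb (induced R A) S j → SelfSufficient S (Finset.univ.map j) →
    ∃ g : B ↪ M, IsEmb S R g ∧ (∀ a : A, g (j a) = a) ∧ SelfSufficient R (Finset.univ.map g)

/-- The dimension `d_M(A)` of a finite set `A`: the minimum of `δ(A')` over the finite sets `A'`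
with `A ⊆ A' ⊆ M`. (In `𝒞̄_n` these integers are bounded below by `0`, so the infimum of this
non-empty set is its minimum.) -/
noncomputable def dim {n : ℕ} {M : Type*} (R : Set (Fin n → M)) (A : Set M) : ℤ :=
  sInf {k : ℤ | ∃ A' : Finset M, A ⊆ ↑A' ∧ predim R A' = k}

/-- The `d`-closure of a set `A`, the union over the finite subsets `A₀` of `A` of
`{c | d_M(A₀ ∪ {c}) = d_M(A₀)}`. This is the closure operation of the pregeometry `PG(M)`. -/
def PG {n : ℕ} {M : Type*} (R : Set (Fin n → M)) (A : Set M) : Set M :=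
  {c | ∃ A₀ : Finset M, ↑A₀ ⊆ A ∧ dim R (insert c ↑A₀) = dim R ↑A₀}

/-- The localization over `Z` of the pregeometry with closure operation `c`. -/
def localization {M : Type*} (c : Set M → Set M) (Z : Set M) : Set M → Set M :=
  fun A => c (Z ∪ A)

/-- Pregeometries, given by their closure operations, are isomorphic: there is a bijection that
respects closure. -/
def Isomorphic {M N : Type*} (c : Set M → Set M) (c' : Set N → Set N) : Prop :=
  ∃ e : M ≃ N, ∀ A : Set M, e '' c A = c' (e '' A)

/-- Pregeometries are locally isomorphic: they become isomorphic after localizing each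
of them over some finite set. -/
def LocallyIsomorphic {M N : Type*} (c : Set M → Set M) (c' : Set N → Set N) : Prop :=
  ∃ (Y : Set M) (Z : Set N), Y.Finite ∧ Z.Finite ∧
    Isomorphic (localization c Y) (localization c' Z)

/-! Existence of generic structures, so that statements about all of them are not vacuous. -/

lemma relsIn_finite {n : ℕ} {M : Type*} (R : Set (Fin n → M)) (A : Finset M) :
    (relsIn R A).Finite := by
  refine (Set.Finite.pi' (fun _ : Fin n => A.finite_toSet)).subset ?_
  intro t ht i
  exact ht.2 i

lemma predim_congr {n : ℕ} {M : Type*} {R R' : Set (Fin n → M)} {A : Finset M}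
    (h : ∀ t, (∀ i, t i ∈ A) → (t ∈ R ↔ t ∈ R')) : predim R A = predim R' A := by
  have : relsIn R A = relsIn R' A := by
    ext t
    constructor
    · rintro ⟨h1, h2⟩; exact ⟨(h t h2).1 h1, h2⟩
    · rintro ⟨h1, h2⟩; exact ⟨(h t h2).2 h1, h2⟩
  rw [predim, predim, this]

lemma predim_map {n : ℕ} {A B : Type*} {S : Set (Fin n → A)} {R : Set (Fin n → B)} {g : A ↪ B}
    (hg : IsEmb S R g) (X : Finset A) : predim R (X.map g) = predim S X := by
  have : relsIn R (X.map g) = (fun t : Fin n → A => fun i => g (t i)) '' relsIn S X := by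
    ext t
    constructor
    · rintro ⟨h1, h2⟩
      simp only [Finset.mem_map] at h2
      choose u hu using h2
      obtain rfl : (fun i => g (u i)) = t := funext fun i => (hu i).2
      exact ⟨u, ⟨(hg u).1 h1, fun i => (hu i).1⟩, rfl⟩
    · rintro ⟨u, ⟨h1, h2⟩, rfl⟩
      exact ⟨(hg u).2 h1, fun i => Finset.mem_map_of_mem g (h2 i)⟩
  rw [predim, predim, this, Set.ncard_image_of_injective, Finset.card_map]
  intro u v huv
  funext i
  exact g.injective (congrFun huv i)

lemma predim_submodular {n : ℕ} {M : Type*} [DecidableEq M] (R : Set (Fin n → M))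
    (A B : Finset M) :
    predim R (A ∪ B) + predim R (A ∩ B) ≤ predim R A + predim R B := by
  have h1 : (relsIn R A ∪ relsIn R B).ncard ≤ (relsIn R (A ∪ B)).ncard := by
    refine Set.ncard_le_ncard ?_ (relsIn_finite _ _)
    rintro t (⟨h, h'⟩ | ⟨h, h'⟩)
    · exact ⟨h, fun i => Finset.mem_union_left _ (h' i)⟩
    · exact ⟨h, fun i => Finset.mem_union_right _ (h' i)⟩
  have h2 : relsIn R A ∩ relsIn R B = relsIn R (A ∩ B) := by
    ext t
    simp only [relsIn, Set.mem_inter_iff, Set.mem_ofPred_eq, Finset.mem_inter, forall_and]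
    tauto
  have h3 := Set.ncard_union_add_ncard_inter (relsIn R A) (relsIn R B) (relsIn_finite _ _)
    (relsIn_finite _ _)
  have h4 := Finset.card_union_add_card_inter A B
  rw [h2] at h3
  simp only [predim]
  omega

/-- Free amalgamation: the predimension in a union of two structures that agree on the
intersection of their universes, all relations lying in one of the two. -/
lemma predim_amalgam {n : ℕ} {M : Type*} [DecidableEq M] {R : Set (Fin n → M)}
    (P Q X : Finset M) (hX : X ⊆ P ∪ Q)
    (h : ∀ t ∈ R, (∀ i, t i ∈ P) ∨ (∀ i, t i ∈ Q)) :
    predim R X = predim R (X ∩ P) + predim R (X ∩ Q) - predim R (X ∩ (P ∩ Q)) := by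
  have h1 : relsIn R X = relsIn R (X ∩ P) ∪ relsIn R (X ∩ Q) := by
    ext t
    simp only [relsIn, Set.mem_union, Set.mem_ofPred_eq, Finset.mem_inter, forall_and]
    have := h t
    tauto
  have h2 : relsIn R (X ∩ P) ∩ relsIn R (X ∩ Q) = relsIn R (X ∩ (P ∩ Q)) := by
    ext t
    simp only [relsIn, Set.mem_inter_iff, Set.mem_ofPred_eq, Finset.mem_inter, forall_and]
    tauto
  have h3 := Set.ncard_union_add_ncard_inter (relsIn R (X ∩ P)) (relsIn R (X ∩ Q))
    (relsIn_finite _ _) (relsIn_finite _ _)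
  have h4 := Finset.card_union_add_card_inter (X ∩ P) (X ∩ Q)
  have h5 : X ∩ P ∪ X ∩ Q = X := by
    rw [← Finset.inter_union_distrib_left]; exact Finset.inter_eq_left.2 hX
  have h6 : (X ∩ P) ∩ (X ∩ Q) = X ∩ (P ∩ Q) := by
    ext; simp only [Finset.mem_inter]; tauto
  rw [h2, ← h1] at h3
  rw [h5, h6] at h4
  simp only [predim]
  omega

/-- One stage structure extends another one, self-sufficiently: `(N, R)` stands for the
structure with universe `{0, …, N-1}` and the relations of `R` among these points. -/
def StageLE {n : ℕ} (p q : ℕ × Set (Fin n → ℕ)) : Prop :=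
  p.1 ≤ q.1 ∧ (∀ t : Fin n → ℕ, (∀ i, t i < p.1) → (t ∈ p.2 ↔ t ∈ q.2)) ∧
  ∀ X ⊆ Finset.range q.1, predim p.2 (X ∩ Finset.range p.1) ≤ predim q.2 X

lemma StageLE.refl {n : ℕ} (p : ℕ × Set (Fin n → ℕ)) : StageLE p p :=
  ⟨le_rfl, fun _ _ => Iff.rfl, fun X hX => by rw [Finset.inter_eq_left.2 hX]⟩

lemma StageLE.trans {n : ℕ} {p q r : ℕ × Set (Fin n → ℕ)} (h : StageLE p q) (h' : StageLE q r) :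
    StageLE p r := by
  refine ⟨h.1.trans h'.1, fun t ht => (h.2.1 t ht).trans
    (h'.2.1 t fun i => (ht i).trans_le h.1), fun X hX => ?_⟩
  have h1 := h'.2.2 X hX
  have h2 := h.2.2 (X ∩ Finset.range q.1) Finset.inter_subset_right
  have h3 : X ∩ Finset.range q.1 ∩ Finset.range p.1 = X ∩ Finset.range p.1 := by
    ext x
    have := h.1
    simp only [Finset.mem_inter, Finset.mem_range]
    constructor
    · tauto
    · rintro ⟨a, b⟩; exact ⟨⟨a, by omega⟩, b⟩
  rw [h3] at h2
  exact h2.trans h1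

lemma stage_step {n : ℕ} (p : ℕ × Set (Fin n → ℕ)) {b : ℕ} (S : Set (Fin n → Fin b))
    (A : Finset ℕ) (j : A ↪ Fin b) :
    ∃ q : ℕ × Set (Fin n → ℕ), p.1 < q.1 ∧ StageLE p q ∧
      (A ⊆ Finset.range p.1 → (∀ Y ⊆ Finset.range p.1, A ⊆ Y → predim p.2 A ≤ predim p.2 Y) →
        IsEmb (induced p.2 A) S j → SelfSufficient S (Finset.univ.map j) →
        ∃ g : Fin b ↪ ℕ, IsEmb S q.2 g ∧ (∀ a : A, g (j a) = a) ∧ (∀ i, g i < q.1) ∧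
          ∀ Y ⊆ Finset.range q.1, Finset.univ.map g ⊆ Y →
            predim q.2 (Finset.univ.map g) ≤ predim q.2 Y) := by
  classical
  by_cases hv : A ⊆ Finset.range p.1 ∧
      (∀ Y ⊆ Finset.range p.1, A ⊆ Y → predim p.2 A ≤ predim p.2 Y) ∧
      IsEmb (induced p.2 A) S j ∧ SelfSufficient S (Finset.univ.map j)
  swap
  · refine ⟨(p.1 + 1, {t | (∀ i, t i < p.1) ∧ t ∈ p.2}), Nat.lt_succ_self _,
      ⟨Nat.le_succ _, fun t ht => ⟨fun h => ⟨ht, h⟩, fun h => h.2⟩, fun X hX => ?_⟩,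
      fun h1 h2 h3 h4 => absurd ⟨h1, h2, h3, h4⟩ hv⟩
    have : relsIn {t | (∀ i, t i < p.1) ∧ t ∈ p.2} X = relsIn p.2 (X ∩ Finset.range p.1) := by
      ext t
      simp only [relsIn, Set.mem_ofPred_eq, Finset.mem_inter, Finset.mem_range, forall_and]
      tauto
    have h2 : (X ∩ Finset.range p.1).card ≤ X.card := Finset.card_le_card Finset.inter_subset_left
    simp only [predim, this]
    omega
  obtain ⟨hA, hAs, hj, hjs⟩ := hv
  obtain ⟨N, R⟩ := p
  simp only at hA hAs hj ⊢
  let g0 : Fin b → ℕ := fun i => if h : ∃ a, j a = i then (h.choose : ℕ) else N + i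
  have hg0 : ∀ a, g0 (j a) = a := by
    intro a
    have h : ∃ a', j a' = j a := ⟨a, rfl⟩
    simp only [g0, dif_pos h]
    exact congrArg _ (j.injective h.choose_spec)
  have hg1 : ∀ i, (¬ ∃ a, j a = i) → g0 i = N + i := fun i h => by simp only [g0, dif_neg h]
  have hAN : ∀ a : A, (a : ℕ) < N := fun a => Finset.mem_range.1 (hA a.2)
  have hg2 : ∀ i, g0 i < N → ∃ a, j a = i := by
    intro i hi
    by_contra hc
    rw [hg1 i hc] at hi
    omega
  have hinj : Function.Injective g0 := by
    intro i i' h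
    by_cases h1 : ∃ a, j a = i <;> by_cases h2 : ∃ a, j a = i'
    · obtain ⟨a, rfl⟩ := h1
      obtain ⟨a', rfl⟩ := h2
      rw [hg0, hg0] at h
      rw [Subtype.ext h]
    · obtain ⟨a, rfl⟩ := h1
      rw [hg0, hg1 _ h2] at h
      have := hAN a
      omega
    · obtain ⟨a, rfl⟩ := h2
      rw [hg0, hg1 _ h1] at h
      have := hAN a
      omega
    · rw [hg1 _ h1, hg1 _ h2] at h
      exact Fin.ext (by omega)
  let g : Fin b ↪ ℕ := ⟨g0, hinj⟩
  have hg : ∀ a, g (j a) = a := hg0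
  have hgb : ∀ i, g i < N + b + 1 := by
    intro i
    by_cases h : ∃ a, j a = i
    · obtain ⟨a, rfl⟩ := h
      rw [hg]
      have := hAN a
      omega
    · change g0 i < _
      rw [hg1 i h]
      have := i.2
      omega
  let Q : Set (Fin n → ℕ) :=
    {t | ((∀ i, t i < N) ∧ t ∈ R) ∨ ∃ u ∈ S, (fun i => g (u i)) = t}
  have hQR : ∀ t : Fin n → ℕ, (∀ i, t i < N) → (t ∈ R ↔ t ∈ Q) := by
    intro t ht
    refine ⟨fun h => Or.inl ⟨ht, h⟩, ?_⟩
    rintro (h | ⟨u, hu, rfl⟩)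
    · exact h.2
    · choose a ha using fun i => hg2 (u i) (ht i)
      have hua : (fun i => j (a i)) = u := funext ha
      have := (hj a).1 (hua ▸ hu)
      have h3 : (fun i => g (u i)) = fun i => (a i : ℕ) := by
        funext i; rw [← ha i, hg]
      rw [h3]
      exact this
  have hemb : IsEmb S Q g := by
    intro u
    refine ⟨?_, fun h => Or.inr ⟨u, h, rfl⟩⟩
    rintro (⟨h1, h2⟩ | ⟨v, hv, huv⟩)
    · choose a ha using fun i => hg2 (u i) (h1 i)
      have hua : (fun i => j (a i)) = u := funext ha
      rw [← hua]
      refine (hj a).2 ?_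
      have h3 : (fun i => g (u i)) = fun i => (a i : ℕ) := by
        funext i; rw [← ha i, hg]
      rw [h3] at h2
      exact h2
    · have : v = u := funext fun i => g.injective (congrFun huv i)
      exact this ▸ hv
  let G : Finset ℕ := Finset.univ.map g
  have hGA : Finset.range N ∩ G = A := by
    ext x
    simp only [Finset.mem_inter, Finset.mem_range, G, Finset.mem_map, Finset.mem_univ, true_and]
    constructor
    · rintro ⟨hx, i, rfl⟩
      obtain ⟨a, rfl⟩ := hg2 i hx
      rw [hg]
      exact a.2
    · intro hx
      exact ⟨hAN ⟨x, hx⟩, j ⟨x, hx⟩, hg _⟩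
  have hcases : ∀ t ∈ Q, (∀ i, t i ∈ Finset.range N) ∨ (∀ i, t i ∈ G) := by
    rintro t (h | ⟨u, hu, rfl⟩)
    · exact Or.inl fun i => Finset.mem_range.2 (h.1 i)
    · exact Or.inr fun i => Finset.mem_map_of_mem g (Finset.mem_univ _)
  -- points outside both parts can be dropped
  have hdrop : ∀ X : Finset ℕ, predim Q (X ∩ (Finset.range N ∪ G)) ≤ predim Q X := by
    intro X
    have h1 : relsIn Q (X ∩ (Finset.range N ∪ G)) = relsIn Q X := by
      ext t
      simp only [relsIn, Set.mem_ofPred_eq, Finset.mem_inter, Finset.mem_union, forall_and]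
      refine ⟨fun h => ⟨h.1, h.2.1⟩, fun h => ⟨h.1, h.2, fun i => ?_⟩⟩
      rcases hcases t h.1 with h' | h'
      · exact Or.inl (h' i)
      · exact Or.inr (h' i)
    have h2 : (X ∩ (Finset.range N ∪ G)).card ≤ X.card :=
      Finset.card_le_card Finset.inter_subset_left
    simp only [predim, h1]
    omega
  have hform : ∀ X : Finset ℕ, predim Q (X ∩ Finset.range N) + predim Q (X ∩ G)
      - predim Q (X ∩ A) ≤ predim Q X := by
    intro X
    have h1 := predim_amalgam (Finset.range N) G (X ∩ (Finset.range N ∪ G))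
      Finset.inter_subset_right hcases
    have e1 : X ∩ (Finset.range N ∪ G) ∩ Finset.range N = X ∩ Finset.range N := by
      ext; simp only [Finset.mem_inter, Finset.mem_union]; tauto
    have e2 : X ∩ (Finset.range N ∪ G) ∩ G = X ∩ G := by
      ext; simp only [Finset.mem_inter, Finset.mem_union]; tauto
    have e3 : X ∩ (Finset.range N ∪ G) ∩ (Finset.range N ∩ G) = X ∩ A := by
      rw [← hGA]; ext; simp only [Finset.mem_inter, Finset.mem_union]; tauto
    rw [e1, e2, e3] at h1
    have := hdrop X
    omega
  have hQN : ∀ X ⊆ Finset.range N, predim R X = predim Q X := fun X hX =>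
    predim_congr fun t ht => hQR t fun i => Finset.mem_range.1 (hX (ht i))
  -- `A` is self-sufficient in the new part
  have hAG : ∀ X ⊆ G, A ⊆ X → predim Q A ≤ predim Q X := by
    intro X hX hAX
    have hA' : A = (Finset.univ.map j).map g := by
      ext x
      simp only [Finset.mem_map, Finset.mem_univ, true_and]
      constructor
      · intro hx; exact ⟨_, ⟨⟨x, hx⟩, rfl⟩, hg _⟩
      · rintro ⟨_, ⟨a, rfl⟩, rfl⟩; rw [hg]; exact a.2
    obtain ⟨Y, hY, rfl⟩ := Finset.subset_map_iff.1 hX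
    rw [hA'] at hAX
    rw [hA', predim_map hemb, predim_map hemb]
    exact hjs Y (Finset.map_subset_map.1 hAX)
  have hAGs : ∀ X : Finset ℕ, predim Q (X ∩ A) ≤ predim Q (X ∩ G) := by
    intro X
    have h1 := predim_submodular Q (X ∩ G) A
    have hAG' : A ⊆ G := hGA ▸ Finset.inter_subset_right
    have h2 := hAG (X ∩ G ∪ A) (Finset.union_subset Finset.inter_subset_right hAG')
      Finset.subset_union_right
    have h3 : X ∩ G ∩ A = X ∩ A := by
      rw [Finset.inter_assoc, Finset.inter_eq_right.2 hAG']
    rw [h3] at h1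
    omega
  refine ⟨(N + b + 1, Q), by simp only; omega, ⟨by simp only; omega, hQR, ?_⟩, ?_⟩
  · intro X _
    have h1 := hform X
    have h2 := hAGs X
    have h3 := hQN (X ∩ Finset.range N) Finset.inter_subset_right
    simp only
    omega
  · intro _ _ _ _
    refine ⟨g, hemb, hg, hgb, ?_⟩
    intro Y _ hGY
    simp only
    have hAG' : A ⊆ G := hGA ▸ Finset.inter_subset_right
    have h1 := hform Y
    have e1 : Y ∩ G = G := Finset.inter_eq_right.2 hGY
    have e2 : Y ∩ A = A := Finset.inter_eq_right.2 (hAG'.trans hGY)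
    rw [e1, e2] at h1
    have h2 := hAs (Y ∩ Finset.range N) Finset.inter_subset_right
      (Finset.subset_inter (hAG'.trans hGY) hA)
    rw [hQN _ hA, hQN _ Finset.inter_subset_right] at h2
    change predim Q G ≤ _
    omega

/-- A generic structure for `(𝒞_n, ≤)` exists, for every `n`: amalgamate freely all tasks one by one,
along an enumeration in which each task occurs infinitely often. -/
theorem exists_isGeneric (n : ℕ) : ∃ R : Set (Fin n → ℕ), IsGeneric R := by
  classical
  let T : Type := Σ b : ℕ, Set (Fin n → Fin b) × (Σ A : Finset ℕ, (A ↪ Fin b))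
  have hT : Countable T := by
    have : ∀ b : ℕ, Countable (Set (Fin n → Fin b) × (Σ A : Finset ℕ, (A ↪ Fin b))) := by
      intro b
      have h1 : ∀ A : Finset ℕ, Countable (A ↪ Fin b) := fun A => Finite.to_countable
      have h2 : Countable (Set (Fin n → Fin b)) := Finite.to_countable
      infer_instance
    infer_instance
  have : Nonempty T := ⟨⟨0, ∅, ∅, ⟨fun a => absurd a.2 (Finset.notMem_empty _),
    fun a => absurd a.2 (Finset.notMem_empty _)⟩⟩⟩
  obtain ⟨e, he⟩ := exists_surjective_nat (T × ℕ)
  let f : ℕ → T := fun s => (e s).1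
  have hf : ∀ (τ : T) (K : ℕ), ∃ s, K ≤ s ∧ f s = τ := by
    intro τ K
    by_contra hc
    push Not at hc
    choose s hs using fun k => he (τ, k)
    have hlt : ∀ k, s k < K := by
      intro k
      by_contra h
      exact hc (s k) (not_lt.1 h) (by simp only [f, hs])
    have hinj : Function.Injective (fun k => (⟨s k, hlt k⟩ : Fin K)) := by
      intro k k' h
      have h' : s k = s k' := congrArg Fin.val h
      have := hs k
      rw [h', hs k'] at this
      exact (congrArg Prod.snd this).symm
    exact not_injective_infinite_finite _ hinj
  choose next hnext using fun (p : ℕ × Set (Fin n → ℕ)) (τ : T) =>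
    stage_step p τ.2.1 τ.2.2.1 τ.2.2.2
  let P : ℕ → ℕ × Set (Fin n → ℕ) := fun s => Nat.rec (0, ∅) (fun s p => next p (f s)) s
  have hP : ∀ s, P (s + 1) = next (P s) (f s) := fun _ => rfl
  have hle : ∀ s t, s ≤ t → StageLE (P s) (P t) := by
    intro s t h
    induction t, h using Nat.le_induction with
    | base => exact StageLE.refl _
    | succ t _ ih => exact ih.trans (hP t ▸ (hnext (P t) (f t)).2.1)
  have hgrow : ∀ s, s ≤ (P s).1 := by
    intro s
    induction s with
    | zero => exact Nat.zero_le _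
    | succ s ih =>
      have := (hnext (P s) (f s)).1
      rw [← hP s] at this
      omega
  let R : Set (Fin n → ℕ) := {t | ∃ s, (∀ i, t i < (P s).1) ∧ t ∈ (P s).2}
  have hR : ∀ s (t : Fin n → ℕ), (∀ i, t i < (P s).1) → (t ∈ R ↔ t ∈ (P s).2) := by
    intro s t ht
    refine ⟨?_, fun h => ⟨s, ht, h⟩⟩
    rintro ⟨s', h1, h2⟩
    rcases le_total s s' with h | h
    · exact ((hle _ _ h).2.1 t ht).2 h2
    · exact ((hle _ _ h).2.1 t h1).1 h2
  have hpre : ∀ s, ∀ X ⊆ Finset.range (P s).1, predim R X = predim (P s).2 X := fun s X hX =>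
    predim_congr fun t ht => hR s t fun i => Finset.mem_range.1 (hX (ht i))
  have hbd : ∀ (X : Finset ℕ) (K : ℕ), ∃ s, K ≤ s ∧ X ⊆ Finset.range (P s).1 := by
    intro X K
    refine ⟨K + X.sup id + 1, by omega, fun x hx => Finset.mem_range.2 ?_⟩
    have h1 : x ≤ X.sup id := Finset.le_sup (f := id) hx
    have h2 := hgrow (K + X.sup id + 1)
    omega
  have hstr : ∀ s, ∀ X : Finset ℕ, predim (P s).2 (X ∩ Finset.range (P s).1) ≤ predim R X := by
    intro s X
    obtain ⟨t, hst, ht⟩ := hbd X s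
    rw [hpre t X ht]
    exact (hle s t hst).2.2 X ht
  refine ⟨R, inferInstance, ?_, ?_⟩
  · intro X
    refine le_trans ?_ (hstr 0 X)
    have : X ∩ Finset.range (P 0).1 = ∅ := by simp [P]
    rw [this]
    simp [predim, relsIn, P]
  · intro A hA B _ S _ j hj hjs
    let b := Fintype.card B
    let ε : B ≃ Fin b := Fintype.equivFin B
    let S' : Set (Fin n → Fin b) := {t | (fun i => ε.symm (t i)) ∈ S}
    have hε : IsEmb S S' ε.toEmbedding := by
      intro t
      simp [S']
    let j' : A ↪ Fin b := j.trans ε.toEmbedding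
    obtain ⟨s0, _, hs0⟩ := hbd A 0
    obtain ⟨s, hs, hfs⟩ := hf ⟨b, S', A, j'⟩ s0
    have hAs : A ⊆ Finset.range (P s).1 := hs0.trans
      (Finset.range_subset_range.2 (hle _ _ hs).1)
    have key := (hnext (P s) (f s)).2.2
    rw [← hP s, hfs] at key
    obtain ⟨g, hg1, hg2, hg3, hg4⟩ := key hAs
      (by
        intro Y hY hAY
        rw [← hpre s A hAs, ← hpre s Y hY]
        exact hA Y hAY)
      (by
        intro t
        have h1 := (hε (fun i => j (t i))).trans (hj t)
        refine h1.trans ?_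
        exact hR s _ fun i => Finset.mem_range.1 (hAs (t i).2))
      (by
        have e1 : Finset.univ.map j' = (Finset.univ.map j).map ε.toEmbedding := by
          rw [Finset.map_map]
        intro Y hY
        have e2 : Y = (Y.map ε.symm.toEmbedding).map ε.toEmbedding := by
          ext; simp
        change predim S' (Finset.univ.map j') ≤ predim S' Y
        change Finset.univ.map j' ⊆ Y at hY
        rw [e1, e2] at hY
        rw [e1, e2, predim_map hε, predim_map hε]
        exact hjs _ (Finset.map_subset_map.1 hY))
    have hgmap : Finset.univ.map (ε.toEmbedding.trans g) = Finset.univ.map g := by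
      ext x
      simp only [Finset.mem_map, Finset.mem_univ, true_and]
      constructor
      · rintro ⟨a, rfl⟩; exact ⟨ε a, rfl⟩
      · rintro ⟨i, rfl⟩; exact ⟨ε.symm i, by simp⟩
    refine ⟨ε.toEmbedding.trans g, ?_, fun a => hg2 a, ?_⟩
    · intro t
      refine Iff.trans ?_ (hε t)
      refine Iff.trans ?_ (hg1 (fun i => ε (t i)))
      exact hR (s + 1) _ fun i => hg3 _
    · rw [hgmap]
      have hsub : Finset.univ.map g ⊆ Finset.range (P (s + 1)).1 := by
        intro x hx
        obtain ⟨i, _, rfl⟩ := Finset.mem_map.1 hx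
        exact Finset.mem_range.2 (hg3 i)
      intro Y hY
      rw [hpre (s + 1) _ hsub]
      refine le_trans ?_ (hstr (s + 1) Y)
      exact hg4 _ Finset.inter_subset_right (Finset.subset_inter hY hsub)

end Predim

/-!
The pregeometry of a generic structure remembers the arity of the relation, because a tuple of the
`n`-ary relation that is as independent as the relation allows is a dependence of rank `n - 1` which
no closed sets of smaller rank account for, whereas every tuple of an `m`-ary relation spans a
closed set of rank at most `m - 1`.

Suppose `m < n` and identify the underlying sets along an isomorphism of `PG_Y(M_m)` with
`PG_Z(M_n)`, so that one set `M` carries an `m`-ary `R` and an `n`-ary `S` with the same closed sets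
over `Y`, respectively `Z`, and hence the same ranks over them (`dim_sub_dim_eq`). Genericity of `S`
gives a tuple `a ∈ S` of rank `n - 1` over `Z` (`IsGeneric.exists_mem_le_dim`). Let `C` be a finite
self-sufficient hull of `Y ∪ a` with respect to `R`, and consider the closures `F x` of `Y ∪ x` for
those `x ⊆ C` that have rank less than `n - 1` over `Y`. Every relation of `R` inside `C` lies in
some `F x`, while no `F x` contains `a`.

Approximate the `F x` by finite self-sufficient subsets that contain bases of all intersections of
the `F x`. By inclusion-exclusion, the number of points of the union of these finite sets minus the
number of relations that lie in one of them is the alternating sum of the dimensions of the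
intersections of the `F x` (`exists_hulls_alternating_sum`). This sum is the same for `R` and for
`S`, up to the constant `dim R Y - dim S Z`. With the number of points of `C` outside all `F x`
added, it is at most `dim R C = dim R (Y ∪ a)` on the side of `R`, because the relations in `C` are
all accounted for (`card_union_sub_card_rels_le`), and at least `dim S (Z ∪ a) + 1` on the side of
`S`, because the relation `a` is not accounted for. This contradicts the equality of the ranks of
`a` (`dim_union_range_lt_of_PG_eq`).
-/

open Finset

namespace Predim

/-! ### The dimension function and its closure operation -/

section Dimension

variable {n : ℕ} {M : Type*} {R : Set (Fin n → M)}

lemma dim_le_predim (hR : InClass R) {A : Set M} {B : Finset M} (h : A ⊆ B) :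
    dim R A ≤ predim R B :=
  csInf_le ⟨0, by rintro _ ⟨B, -, rfl⟩; exact hR B⟩ ⟨B, h, rfl⟩

lemma exists_predim_eq_dim (hR : InClass R) {A : Set M} (hA : A.Finite) :
    ∃ B : Finset M, A ⊆ B ∧ predim R B = dim R A := by
  have hne : {k : ℤ | ∃ B : Finset M, A ⊆ ↑B ∧ predim R B = k}.Nonempty :=
    ⟨_, hA.toFinset, by simp, rfl⟩
  exact Int.csInf_mem hne ⟨0, by rintro _ ⟨B, -, rfl⟩; exact hR B⟩

lemma dim_mono (hR : InClass R) {A B : Set M} (hB : B.Finite) (h : A ⊆ B) :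
    dim R A ≤ dim R B := by
  obtain ⟨B', hB', e⟩ := exists_predim_eq_dim hR hB
  exact e ▸ dim_le_predim hR (h.trans hB')

lemma dim_submodular (hR : InClass R) {A B D : Set M} (hA : A.Finite) (hB : B.Finite)
    (hDA : D ⊆ A) (hDB : D ⊆ B) : dim R (A ∪ B) + dim R D ≤ dim R A + dim R B := by
  classical
  obtain ⟨A', hA', eA⟩ := exists_predim_eq_dim hR hA
  obtain ⟨B', hB', eB⟩ := exists_predim_eq_dim hR hB
  have h1 : dim R (A ∪ B) ≤ predim R (A' ∪ B') :=
    dim_le_predim hR (by push_cast; exact Set.union_subset_union hA' hB')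
  have h2 : dim R D ≤ predim R (A' ∩ B') :=
    dim_le_predim hR (by push_cast; exact Set.subset_inter (hDA.trans hA') (hDB.trans hB'))
  have h3 := predim_submodular R A' B'
  omega

lemma dim_insert_le (hR : InClass R) {A : Set M} (hA : A.Finite) (c : M) :
    dim R (insert c A) ≤ dim R A + 1 := by
  classical
  obtain ⟨B, hB, e⟩ := exists_predim_eq_dim hR hA
  have h1 : dim R (insert c A) ≤ predim R (insert c B) :=
    dim_le_predim hR (by push_cast; exact Set.insert_subset_insert hB)
  have h2 : (relsIn R B).ncard ≤ (relsIn R (insert c B)).ncard :=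
    Set.ncard_le_ncard (fun t ht => ⟨ht.1, fun i => Finset.mem_insert_of_mem (ht.2 i)⟩)
      (relsIn_finite _ _)
  have h3 := Finset.card_insert_le c B
  simp only [predim] at h1 e
  omega

lemma SelfSufficient.dim_eq (hR : InClass R) {A : Finset M} (hA : SelfSufficient R A) :
    dim R A = predim R A := by
  obtain ⟨B, hB, e⟩ := exists_predim_eq_dim hR A.finite_toSet
  exact le_antisymm (dim_le_predim hR subset_rfl) (e ▸ hA B (by exact_mod_cast hB))

lemma selfSufficient_of_predim_eq_dim (hR : InClass R) {A : Set M} {B : Finset M} (h : A ⊆ B)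
    (e : predim R B = dim R A) : SelfSufficient R B := fun D hD =>
  e ▸ dim_le_predim hR (h.trans (by exact_mod_cast hD))

lemma SelfSufficient.predim_inter_le [DecidableEq M] {A : Finset M} (hA : SelfSufficient R A)
    (X : Finset M) : predim R (X ∩ A) ≤ predim R X := by
  have h1 := predim_submodular R X A
  have h2 := hA (X ∪ A) Finset.subset_union_right
  omega

lemma SelfSufficient.inter [DecidableEq M] {A B : Finset M} (hA : SelfSufficient R A)
    (hB : SelfSufficient R B) : SelfSufficient R (A ∩ B) := by
  intro X hX
  have h : X ∩ A ∩ B = A ∩ B := by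
    ext c
    have := @hX c
    simp only [Finset.mem_inter] at this ⊢
    tauto
  exact h ▸ (hB.predim_inter_le (X ∩ A)).trans (hA.predim_inter_le X)

lemma dim_union_eq_of_dim_eq (hR : InClass R) {A B D : Set M} (hB : B.Finite) (hD : D.Finite)
    (hAB : A ⊆ B) (hAD : A ⊆ D) (h : dim R D = dim R A) : dim R (B ∪ D) = dim R B := by
  have h1 := dim_submodular hR hB hD hAB hAD
  have h2 := dim_mono hR (hB.union hD) (Set.subset_union_left (s := B) (t := D))
  omega

lemma mem_PG_iff (hR : InClass R) {A : Set M} (hA : A.Finite) {c : M} :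
    c ∈ PG R A ↔ dim R (insert c A) = dim R A := by
  constructor
  · rintro ⟨A₀, h0, h⟩
    have h1 := dim_union_eq_of_dim_eq hR hA (A₀.finite_toSet.insert c) h0
      (Set.subset_insert _ _) h
    have h2 : A ∪ insert c ↑A₀ = insert c A := by
      rw [Set.union_insert, Set.union_eq_left.2 h0]
    rwa [h2] at h1
  · intro h
    exact ⟨hA.toFinset, by simp, by simpa using h⟩

lemma subset_PG (A : Set M) : A ⊆ PG R A := fun c hc =>
  ⟨{c}, by simpa using hc, by simp⟩

lemma dim_union_eq (hR : InClass R) {A X : Set M} (hA : A.Finite) (hX : X.Finite)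
    (h : X ⊆ PG R A) : dim R (A ∪ X) = dim R A := by
  induction X, hX using Set.Finite.induction_on with
  | empty => simp
  | @insert c X _ hX ih =>
    have hc := (mem_PG_iff hR hA).1 (h (Set.mem_insert _ _))
    have h1 := dim_union_eq_of_dim_eq hR (hA.union hX) (hA.insert c)
      Set.subset_union_left (Set.subset_insert _ _) hc
    have h2 : A ∪ X ∪ insert c A = A ∪ insert c X := by
      ext; simp only [Set.mem_union, Set.mem_insert_iff]; tauto
    rw [h2, ih ((Set.subset_insert _ _).trans h)] at h1
    exact h1

lemma dim_eq_of_subset_of_subset_PG (hR : InClass R) {A X : Set M} (hX : X.Finite)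
    (hAX : A ⊆ X) (h : X ⊆ PG R A) : dim R X = dim R A := by
  have := dim_union_eq hR (hX.subset hAX) hX h
  rwa [Set.union_eq_right.2 hAX] at this

lemma PG_PG_subset (hR : InClass R) {A : Set M} (hA : A.Finite) : PG R (PG R A) ⊆ PG R A := by
  rintro c ⟨X, hX, h⟩
  have hX' := X.finite_toSet
  have h1 := dim_union_eq hR hA hX' hX
  have h2 := dim_union_eq_of_dim_eq hR (hA.union hX') (hX'.insert c)
    Set.subset_union_right (Set.subset_insert _ _) h
  have h3 : dim R (insert c A) ≤ dim R (A ∪ X ∪ insert c X) :=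
    dim_mono hR ((hA.union hX').union (hX'.insert c)) (by
      intro x; simp only [Set.mem_union, Set.mem_insert_iff]; tauto)
  have h4 := dim_mono hR (hA.insert c) (Set.subset_insert c A)
  exact (mem_PG_iff hR hA).2 (by omega)

/-- A finite subset of a closed set has a self-sufficient finite hull inside the closed set. -/
lemma exists_hull (hR : InClass R) {F : Set M} (hF : PG R F ⊆ F) (K : Finset M)
    (hK : ↑K ⊆ F) : ∃ H : Finset M, K ⊆ H ∧ ↑H ⊆ F ∧ SelfSufficient R H := by
  obtain ⟨H, hKH, e⟩ := exists_predim_eq_dim hR K.finite_toSet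
  refine ⟨H, by exact_mod_cast hKH, fun c hc => hF ⟨K, hK, ?_⟩,
    selfSufficient_of_predim_eq_dim hR hKH e⟩
  have h1 : dim R (insert c ↑K) ≤ predim R H := dim_le_predim hR (Set.insert_subset hc hKH)
  have h2 := dim_mono hR (K.finite_toSet.insert c) (Set.subset_insert c (K : Set M))
  omega

/-- Subsets of the closure of a finite set are spanned, over a finite set `Y`, by finitely many of
their elements. -/
lemma exists_finite_basis (hR : InClass R) {A Y F : Set M} (hA : A.Finite) (hY : Y.Finite)
    (hYA : Y ⊆ A) (hF : F ⊆ PG R A) :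
    ∃ b : Finset M, ↑b ⊆ F ∧ F ⊆ PG R (Y ∪ b) := by
  have hbd : ∀ b : Finset M, ↑b ⊆ F → dim R (Y ∪ b) ≤ dim R A := fun b hb =>
    (dim_mono hR (hA.union b.finite_toSet) (Set.union_subset_union_left _ hYA)).trans_eq
      (dim_union_eq hR hA b.finite_toSet (hb.trans hF))
  let V : Set ℤ := {k | ∃ b : Finset M, ↑b ⊆ F ∧ dim R (Y ∪ b) = k}
  have hV : sSup V ∈ V := Int.csSup_mem ⟨_, ∅, by simp, rfl⟩
    ⟨dim R A, by rintro _ ⟨b, hb, rfl⟩; exact hbd b hb⟩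
  obtain ⟨b, hb, e⟩ := hV
  refine ⟨b, hb, fun c hc => (mem_PG_iff hR (hY.union b.finite_toSet)).2 ?_⟩
  classical
  have h1 : dim R (Y ∪ ↑(insert c b)) ≤ sSup V :=
    le_csSup ⟨dim R A, by rintro _ ⟨b, hb, rfl⟩; exact hbd b hb⟩
      ⟨insert c b, by push_cast; exact Set.insert_subset hc hb, rfl⟩
  rw [Finset.coe_insert, Set.union_insert] at h1
  have h2 := dim_mono hR ((hY.union b.finite_toSet).insert c) (Set.subset_insert c _)
  omega

lemma dim_union_range_lt (hR : InClass R) (hn : n ≠ 0) {Y : Set M} (hY : Y.Finite)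
    {t : Fin n → M} (ht : t ∈ R) : dim R (Y ∪ Set.range t) < dim R Y + n := by
  classical
  obtain ⟨B, hB, e⟩ := exists_predim_eq_dim hR hY
  have hn' : (0 : ℤ) < n := by exact_mod_cast Nat.pos_of_ne_zero hn
  have h1 : dim R (Y ∪ Set.range t) ≤ predim R (B ∪ univ.image t) :=
    dim_le_predim hR (by push_cast; simpa using Set.union_subset_union_left _ hB)
  by_cases h : ∀ i, t i ∈ B
  · have : B ∪ univ.image t = B := by
      rw [Finset.union_eq_left]
      intro x hx
      obtain ⟨i, -, rfl⟩ := Finset.mem_image.1 hx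
      exact h i
    rw [this] at h1
    omega
  · have h2 : (insert t (relsIn R B)).ncard ≤ (relsIn R (B ∪ univ.image t)).ncard := by
      refine Set.ncard_le_ncard ?_ (relsIn_finite _ _)
      rintro u (rfl | hu)
      · exact ⟨ht, fun i => by simp⟩
      · exact ⟨hu.1, fun i => Finset.mem_union_left _ (hu.2 i)⟩
    rw [Set.ncard_insert_of_notMem (fun hh => h hh.2) (relsIn_finite _ _)] at h2
    have h3 := Finset.card_union_le B (univ.image t)
    have h4 : (univ.image t).card ≤ n := Finset.card_image_le.trans_eq (by simp)
    simp only [predim] at h1 e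
    omega

end Dimension

/-! ### Alternating sums of dimensions -/

section Hulls

variable {n : ℕ} {M : Type*} {R : Set (Fin n → M)}

/-- `R^A` as a `Finset`. -/
noncomputable def rels (R : Set (Fin n → M)) (A : Finset M) : Finset (Fin n → M) :=
  (relsIn_finite R A).toFinset

lemma mem_rels {A : Finset M} {t : Fin n → M} : t ∈ rels R A ↔ t ∈ R ∧ ∀ i, t i ∈ A := by
  simp [rels, relsIn]

lemma predim_eq (A : Finset M) : predim R A = #A - #(rels R A) := by
  rw [predim, rels, Set.ncard_eq_toFinset_card _ (relsIn_finite R A)]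

/-- Inclusion-exclusion for points and relations at once: if the closed sets `F i` are replaced by
finite self-sufficient subsets `G i` that contain bases `b t` of the intersections of the `F i`,
then the alternating sum of the dimensions of these intersections counts the points of `⋃ G i` minus
the relations that lie in one of the `G i`. Moreover `G i` can be chosen to contain `C ∩ F i`. -/
lemma exists_hulls_alternating_sum [DecidableEq M] {ι : Type*} (hR : InClass R) (s : Finset ι)
    (F : ι → Set M) (hF : ∀ i ∈ s, PG R (F i) ⊆ F i) (b : Finset ι → Finset M)
    (hb : ∀ t ⊆ s, ∀ i ∈ t, ↑(b t) ⊆ F i)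
    (hbF : ∀ t ⊆ s, t.Nonempty → ∀ c, (∀ i ∈ t, c ∈ F i) → c ∈ PG R (b t)) (C : Finset M) :
    ∃ G : ι → Finset M, (∀ i ∈ s, ↑(G i) ⊆ F i) ∧ (∀ i ∈ s, ∀ c ∈ C, c ∈ F i → c ∈ G i) ∧
      (∀ i ∈ s, SelfSufficient R (G i)) ∧ (∀ t ⊆ s, ∀ i ∈ t, b t ⊆ G i) ∧
      (#(s.biUnion G) : ℤ) - #(s.biUnion fun i => rels R (G i)) =
        ∑ t : s.powerset.filter (·.Nonempty), (-1 : ℤ) ^ (#t.1 + 1) * dim R (b t.1) := by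
  classical
  have h : ∀ i, ∃ H : Finset M, i ∈ s → C.filter (· ∈ F i) ∪
      (s.powerset.filter (i ∈ ·)).biUnion b ⊆ H ∧ ↑H ⊆ F i ∧ SelfSufficient R H := by
    intro i
    by_cases hi : i ∈ s
    · obtain ⟨H, hH⟩ := exists_hull hR (hF i hi)
        (C.filter (· ∈ F i) ∪ (s.powerset.filter (i ∈ ·)).biUnion b) (by
          intro c hc
          simp only [Finset.coe_union, Set.mem_union, Finset.mem_coe, Finset.mem_filter,
            Finset.mem_biUnion, Finset.mem_powerset] at hc
          rcases hc with hc | ⟨t, ⟨hts, hit⟩, hc⟩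
          · exact hc.2
          · exact hb t hts i hit hc)
      exact ⟨H, fun _ => hH⟩
    · exact ⟨∅, fun hi' => absurd hi' hi⟩
  choose G hG using h
  have hbG : ∀ t ⊆ s, ∀ i ∈ t, b t ⊆ G i := fun t hts i hit =>
    (Finset.subset_biUnion_of_mem b (by simp [hts, hit])).trans
      (Finset.subset_union_right.trans (hG i (hts hit)).1)
  refine ⟨G, fun i hi => (hG i hi).2.1, fun i hi c hc hcF => (hG i hi).1
    (Finset.mem_union_left _ (by simp [hc, hcF])), fun i hi => (hG i hi).2.2, hbG, ?_⟩
  rw [Finset.inclusion_exclusion_card_biUnion, Finset.inclusion_exclusion_card_biUnion,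
    ← Finset.sum_sub_distrib]
  refine Finset.sum_congr rfl fun ⟨t, ht⟩ _ => ?_
  rw [← mul_sub]
  congr 1
  simp only [Finset.mem_filter, Finset.mem_powerset] at ht
  obtain ⟨hts, hne⟩ := ht
  have hmem : ∀ c, c ∈ t.inf' hne G ↔ ∀ i ∈ t, c ∈ G i := by
    intro c
    rw [← Finset.singleton_subset_iff, Finset.le_inf'_iff]
    simp
  have hrels : t.inf' hne (fun i => rels R (G i)) = rels R (t.inf' hne G) := by
    ext u
    rw [← Finset.singleton_subset_iff, Finset.le_inf'_iff]
    simp only [Finset.singleton_subset_iff, mem_rels, hmem]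
    constructor
    · intro h
      exact ⟨(h _ hne.choose_spec).1, fun k i hi => (h i hi).2 k⟩
    · exact fun h i hi => ⟨h.1, fun k => h.2 k i hi⟩
  have hss : SelfSufficient R (t.inf' hne G) :=
    Finset.inf'_induction hne G (p := SelfSufficient R) (fun _ ha _ hb => ha.inter hb)
      fun i hi => (hG i (hts hi)).2.2
  rw [hrels, ← predim_eq, ← hss.dim_eq hR]
  refine dim_eq_of_subset_of_subset_PG hR (Finset.finite_toSet _) ?_ ?_
  · intro c hc
    exact (hmem c).2 fun i hi => hbG t hts i hi hc
  · intro c hc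
    exact hbF t hts hne c fun i hi => (hG i (hts hi)).2.1 ((hmem c).1 hc i hi)

/-- Adjoining to `C` finite sets `G i` that are spanned by their intersections with `C`, together
with the relations inside the `G i`, does not raise the predimension. -/
lemma card_union_sub_card_rels_le [DecidableEq M] {ι : Type*} (hR : InClass R) (C : Finset M)
    (s : Finset ι) (G : ι → Finset M)
    (hG : ∀ i ∈ s, predim R (G i) ≤ dim R (↑(C ∩ G i) : Set M)) :
    (#(C ∪ s.biUnion G) : ℤ) - #(rels R C ∪ s.biUnion fun i => rels R (G i)) ≤ predim R C := by
  classical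
  induction s using Finset.induction_on with
  | empty => simp [predim_eq]
  | @insert i s hi ih =>
    specialize ih fun j hj => hG j (Finset.mem_insert_of_mem hj)
    set X := C ∪ s.biUnion G with hX
    set W := rels R C ∪ s.biUnion fun i => rels R (G i) with hW
    have e1 : C ∪ (insert i s).biUnion G = X ∪ G i := by
      rw [Finset.biUnion_insert, hX]
      ext; simp only [Finset.mem_union]; tauto
    have e2 : (rels R C ∪ (insert i s).biUnion fun i => rels R (G i)) = W ∪ rels R (G i) := by
      rw [Finset.biUnion_insert, hW]
      ext; simp only [Finset.mem_union]; tauto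
    have hWX : ∀ t ∈ W, ∀ k, t k ∈ X := by
      intro t ht k
      simp only [hW, hX, Finset.mem_union, Finset.mem_biUnion, mem_rels] at ht ⊢
      rcases ht with ht | ⟨j, hj, ht⟩
      · exact Or.inl (ht.2 k)
      · exact Or.inr ⟨j, hj, ht.2 k⟩
    have h1 : predim R (G i) ≤ predim R (X ∩ G i) :=
      (hG i (Finset.mem_insert_self _ _)).trans (dim_le_predim hR (by
        exact_mod_cast Finset.inter_subset_inter_right Finset.subset_union_left))
    have h2 : #(W ∩ rels R (G i)) ≤ #(rels R (X ∩ G i)) := by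
      refine Finset.card_le_card fun t ht => ?_
      rw [Finset.mem_inter, mem_rels (A := G i)] at ht
      exact mem_rels.2 ⟨ht.2.1, fun k => Finset.mem_inter.2 ⟨hWX t ht.1 k, ht.2.2 k⟩⟩
    have h3 := Finset.card_union_add_card_inter X (G i)
    have h4 := Finset.card_union_add_card_inter W (rels R (G i))
    rw [e1, e2]
    rw [predim_eq, predim_eq] at h1
    omega

lemma sum_nonempty_powerset_neg_one {ι : Type*} (s : Finset ι) (hs : s.Nonempty) :
    ∑ t : s.powerset.filter (·.Nonempty), (-1 : ℤ) ^ (#t.1 + 1) = 1 := by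
  have h := Finset.inclusion_exclusion_card_biUnion s fun _ => ({()} : Finset Unit)
  have e : s.biUnion (fun _ => ({()} : Finset Unit)) = {()} := by
    obtain ⟨i, hi⟩ := hs
    ext; simpa using ⟨i, hi⟩
  rw [e] at h
  simpa [Finset.inf'_const] using h.symm

end Hulls

/-! ### Comparing two structures with the same localized pregeometry -/

section Comparison

variable {m n : ℕ} {M : Type*} {R : Set (Fin m → M)} {S : Set (Fin n → M)}

/-- The dimension relative to `Y` is determined by the closure operation localized at `Y`. -/
lemma dim_sub_dim_eq (hR : InClass R) (hS : InClass S) {Y Z : Set M} (hY : Y.Finite)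
    (hZ : Z.Finite) (h : ∀ A, PG R (Y ∪ A) = PG S (Z ∪ A)) {A : Set M} (hA : A.Finite) :
    dim R (Y ∪ A) - dim R Y = dim S (Z ∪ A) - dim S Z := by
  induction A, hA using Set.Finite.induction_on with
  | empty => simp
  | @insert c A _ hA ih =>
    have h1 := mem_PG_iff hR (hY.union hA) (c := c)
    have h2 := mem_PG_iff hS (hZ.union hA) (c := c)
    rw [h A, h2] at h1
    have h3 := dim_insert_le hR (hY.union hA) c
    have h4 := dim_insert_le hS (hZ.union hA) c
    have h5 := dim_mono hR ((hY.union hA).insert c) (Set.subset_insert c _)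
    have h6 := dim_mono hS ((hZ.union hA).insert c) (Set.subset_insert c _)
    rw [Set.union_insert, Set.union_insert]
    omega

/-- Two structures on the same set, of arities `m < n`, whose pregeometries agree after localizing
at finite sets `Y` and `Z`: then no tuple of the `n`-ary relation has the maximal
dimension `n - 1` over `Z`. -/
theorem dim_union_range_lt_of_PG_eq (hR : InClass R) (hS : InClass S) (hm : m ≠ 0) (hmn : m < n)
    {Y Z : Finset M} (h : ∀ A : Set M, PG R (↑Y ∪ A) = PG S (↑Z ∪ A)) {a : Fin n → M}
    (ha : a ∈ S) : dim S (↑Z ∪ Set.range a) < dim S Z + (n - 1) := by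
  classical
  by_contra! hlt
  have hYf : (Y : Set M).Finite := Y.finite_toSet
  have hZf : (Z : Set M).Finite := Z.finite_toSet
  have hrk := fun {A : Set M} (hA : A.Finite) => dim_sub_dim_eq hR hS hYf hZf h hA
  obtain ⟨C, hC, hCdim⟩ := exists_predim_eq_dim hR (hYf.union (Set.finite_range a))
  have hYC : Y ⊆ C := by exact_mod_cast (Set.subset_union_left.trans hC : (Y : Set M) ⊆ C)
  have haC : ∀ i, a i ∈ C := fun i => hC (Or.inr ⟨i, rfl⟩)
  let s : Finset (Finset M) :=
    C.powerset.filter fun x => dim R (↑Y ∪ ↑x) < dim R (Y : Set M) + (n - 1)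
  let F : Finset M → Set M := fun x => PG R (↑Y ∪ ↑x)
  have hfin : ∀ x : Finset M, ((Y : Set M) ∪ ↑x).Finite := fun x => hYf.union x.finite_toSet
  have hfinZ : ∀ x : Finset M, ((Z : Set M) ∪ ↑x).Finite := fun x => hZf.union x.finite_toSet
  have hFS : ∀ x, F x = PG S (↑Z ∪ ↑x) := fun x => h x
  have hYF : ∀ x, (Y : Set M) ⊆ F x := fun x => Set.subset_union_left.trans (subset_PG _)
  have hxF : ∀ x : Finset M, (x : Set M) ⊆ F x := fun x =>
    Set.subset_union_right.trans (subset_PG _)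
  have hZF : ∀ x, (Z : Set M) ⊆ F x := fun x =>
    hFS x ▸ Set.subset_union_left.trans (subset_PG _)
  have hs : ∀ {x}, x ∈ s ↔ x ⊆ C ∧ dim R (↑Y ∪ ↑x) < dim R (Y : Set M) + (n - 1) := by
    intro x; simp [s]
  have hempty : ∅ ∈ s := hs.2 ⟨Finset.empty_subset _, by simp; omega⟩
  -- Every relation of `R` in `C` lies in some `F x`, as its dimension over `Y` is at most `m - 1`.
  have hrelF : ∀ t ∈ rels R C, univ.image t ∈ s := by
    intro t ht
    rw [mem_rels] at ht
    have h1 := dim_union_range_lt hR hm hYf ht.1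
    refine hs.2 ⟨fun x hx => ?_, ?_⟩
    · obtain ⟨i, -, rfl⟩ := Finset.mem_image.1 hx
      exact ht.2 i
    · rw [Finset.coe_image, Finset.coe_univ, Set.image_univ]
      omega
  -- No `F x` contains the tuple `a`, whose dimension over `Z` is at least `n - 1`.
  have haF : ∀ x ∈ s, ¬ ∀ i, a i ∈ F x := by
    intro x hx hax
    have h1 := dim_union_eq hR (hfin x) (Set.finite_range a) (by rintro _ ⟨i, rfl⟩; exact hax i)
    have h2 := dim_mono hR ((hfin x).union (Set.finite_range a))
      (Set.union_subset_union_left (Set.range a)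
        (Set.subset_union_left : (Y : Set M) ⊆ ↑Y ∪ ↑x))
    have h3 := (hs.1 hx).2
    have h4 := hrk (Set.finite_range a)
    omega
  have hbasis : ∀ t : Finset (Finset M), ∃ b : Finset M, t ⊆ s → t.Nonempty →
      (∀ x ∈ t, (b : Set M) ⊆ F x) ∧
        ∀ c, (∀ x ∈ t, c ∈ F x) → c ∈ PG R (↑Y ∪ ↑b : Set M) := by
    intro t
    by_cases ht : t.Nonempty
    · obtain ⟨y, hy⟩ := ht
      obtain ⟨b, hb, hb'⟩ := exists_finite_basis hR (hfin y) hYf Set.subset_union_left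
        (F := {c | ∀ x ∈ t, c ∈ F x}) (fun c hc => hc y hy)
      exact ⟨b, fun _ _ => ⟨fun x hx c hc => hb hc x hx, fun c hc => hb' hc⟩⟩
    · exact ⟨∅, fun _ h => absurd h ht⟩
  choose b hb using hbasis
  obtain ⟨G, hGF, hCG, hGs, -, hGsum⟩ := exists_hulls_alternating_sum hR s F
    (fun x _ => PG_PG_subset hR (hfin x)) (fun t => Y ∪ b t)
    (fun t hts x hx => by
      rw [Finset.coe_union]
      exact Set.union_subset (hYF x) ((hb t hts ⟨x, hx⟩).1 x hx))
    (fun t hts hne c hc => by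
      rw [Finset.coe_union]
      exact (hb t hts hne).2 c hc) C
  obtain ⟨G', hGF', hCG', -, hbG', hGsum'⟩ := exists_hulls_alternating_sum hS s F
    (fun x _ => by rw [hFS]; exact PG_PG_subset hS (hfinZ x)) (fun t => Z ∪ b t)
    (fun t hts x hx => by
      rw [Finset.coe_union]
      exact Set.union_subset (hZF x) ((hb t hts ⟨x, hx⟩).1 x hx))
    (fun t hts hne c hc => by
      rw [Finset.coe_union, ← h]
      exact (hb t hts hne).2 c hc) C
  have hsum : ∑ t : s.powerset.filter (·.Nonempty),
        (-1 : ℤ) ^ (#t.1 + 1) * dim R (↑(Y ∪ b t.1) : Set M) -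
      ∑ t : s.powerset.filter (·.Nonempty),
        (-1 : ℤ) ^ (#t.1 + 1) * dim S (↑(Z ∪ b t.1) : Set M) = dim R Y - dim S Z := by
    have h1 := congrArg (· * (dim R Y - dim S Z)) (sum_nonempty_powerset_neg_one s ⟨_, hempty⟩)
    simp only [one_mul, Finset.sum_mul] at h1
    rw [← Finset.sum_sub_distrib, ← h1]
    refine Finset.sum_congr rfl fun t _ => ?_
    rw [← mul_sub]
    congr 1
    have := hrk (b t.1).finite_toSet
    push_cast
    omega
  -- The points of `C` outside all `F x` are the same on both sides.
  have hout : ∀ H : Finset M → Finset M, (∀ x ∈ s, (H x : Set M) ⊆ F x) →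
      (∀ x ∈ s, ∀ c ∈ C, c ∈ F x → c ∈ H x) →
      #(C ∪ s.biUnion H) = #(s.biUnion H) + #(C.filter fun c => ∀ x ∈ s, c ∉ F x) := by
    intro H hHF hCH
    have e : C.filter (fun c => ∀ x ∈ s, c ∉ F x) = C \ s.biUnion H := by
      ext c
      simp only [Finset.mem_filter, Finset.mem_sdiff, Finset.mem_biUnion, not_exists, not_and]
      exact and_congr_right fun hc => forall₂_congr fun x hx =>
        not_congr ⟨hCH x hx c hc, fun hh => hHF x hx hh⟩
    rw [e, ← Finset.sdiff_union_self_eq_union,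
      Finset.card_union_of_disjoint Finset.sdiff_disjoint, add_comm]
  have hout1 := hout G hGF hCG
  have hout2 := hout G' hGF' hCG'
  -- In `R`, the alternating sum is at most the dimension of `C`.
  have hRside : (#(C ∪ s.biUnion G) : ℤ) - #(s.biUnion fun x => rels R (G x)) ≤ predim R C := by
    have h1 := card_union_sub_card_rels_le hR C s G (by
      intro x hx
      rw [← (hGs x hx).dim_eq hR]
      have hsub : (↑Y ∪ ↑x : Set M) ⊆ ↑(C ∩ G x) := by
        rintro c (hc | hc)
        · exact Finset.mem_coe.2 (Finset.mem_inter.2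
            ⟨hYC hc, hCG x hx c (hYC hc) (hYF x hc)⟩)
        · have hcC := (hs.1 hx).1 hc
          exact Finset.mem_coe.2 (Finset.mem_inter.2 ⟨hcC, hCG x hx c hcC (hxF x hc)⟩)
      rw [dim_eq_of_subset_of_subset_PG hR (G x).finite_toSet
        (hsub.trans (by exact_mod_cast Finset.inter_subset_right)) (hGF x hx)]
      exact dim_mono hR (Finset.finite_toSet _) hsub)
    have h2 : rels R C ∪ (s.biUnion fun x => rels R (G x)) =
        s.biUnion fun x => rels R (G x) := by
      rw [Finset.union_eq_right]
      intro t ht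
      refine Finset.mem_biUnion.2 ⟨_, hrelF t ht, ?_⟩
      rw [mem_rels] at ht ⊢
      exact ⟨ht.1, fun i => hCG _ (hrelF t (mem_rels.2 ht)) _ (ht.2 i) (hxF _ (by simp))⟩
    rwa [h2] at h1
  -- In `S`, the tuple `a` is a relation outside all `G' x`.
  have hSside : dim S (↑Z ∪ Set.range a) + 1 ≤
      (#(C ∪ s.biUnion G') : ℤ) - #(s.biUnion fun x => rels S (G' x)) := by
    have h1 : dim S (↑Z ∪ Set.range a) ≤ predim S (C ∪ s.biUnion G') := by
      refine dim_le_predim hS ?_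
      rintro c (hc | ⟨i, rfl⟩)
      · exact Finset.mem_coe.2 (Finset.mem_union_right _ (Finset.mem_biUnion.2 ⟨∅, hempty,
          hbG' {∅} (by simpa using hempty) ∅ (by simp) (Finset.mem_union_left _ hc)⟩))
      · exact Finset.mem_coe.2 (Finset.mem_union_left _ (haC i))
    have h2 : insert a (s.biUnion fun x => rels S (G' x)) ⊆ rels S (C ∪ s.biUnion G') := by
      intro t ht
      simp only [Finset.mem_insert, Finset.mem_biUnion, mem_rels, Finset.mem_union] at ht ⊢
      rcases ht with rfl | ⟨x, hx, ht⟩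
      · exact ⟨ha, fun i => Or.inl (haC i)⟩
      · exact ⟨ht.1, fun i => Or.inr ⟨x, hx, ht.2 i⟩⟩
    have h3 := Finset.card_le_card h2
    rw [Finset.card_insert_of_notMem] at h3
    · rw [predim_eq] at h1
      omega
    · simp only [Finset.mem_biUnion, mem_rels, not_exists, not_and]
      exact fun x hx _ hax => haF x hx fun i => hGF' x hx (hax i)
  have h4 := hrk (Set.finite_range a)
  omega

end Comparison

/-! ### Generic tuples and transport along a bijection -/

section Generic

variable {n : ℕ} {N : Type*} {S : Set (Fin n → N)}

/-- Over any finite set, a generic structure contains a related tuple of the largest dimension that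
the relation permits. -/
lemma IsGeneric.exists_mem_le_dim (hS : IsGeneric S) (hn : n ≠ 0) (Z : Finset N) :
    ∃ a ∈ S, dim S Z + (n - 1) ≤ dim S (↑Z ∪ Set.range a) := by
  classical
  have hC := hS.inClass
  obtain ⟨H, hZH, eH⟩ := exists_predim_eq_dim hC Z.finite_toSet
  have hH : SelfSufficient S H := selfSufficient_of_predim_eq_dim hC hZH eH
  -- The extension of `H` by `n` new points and a single new relation, which holds of these points.
  let ε : H ≃ Fin #H := H.equivFin
  let j : H ↪ Fin #H ⊕ Fin n := ε.toEmbedding.trans Function.Embedding.inl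
  let T : Set (Fin n → Fin #H ⊕ Fin n) :=
    insert Sum.inr ((fun u i => j (u i)) '' induced S H)
  have hn' : 0 < n := Nat.pos_of_ne_zero hn
  have hj : IsEmb (induced S H) T j := by
    intro t
    constructor
    · rintro (h | ⟨u, hu, h⟩)
      · exact absurd (congrFun h ⟨0, hn'⟩) (by simp [j])
      · have : u = t := funext fun i => j.injective (congrFun h i)
        exact this ▸ hu
    · exact fun h => Or.inr ⟨t, h, rfl⟩
  have hval : IsEmb (induced S H) S (Function.Embedding.subtype (· ∈ H)) := fun t => Iff.rfl
  have hpre : ∀ X : Finset H, predim T (X.map j) =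
      predim S (X.map (Function.Embedding.subtype (· ∈ H))) := fun X => by
    rw [predim_map hj, predim_map hval]
  have hmemj : ∀ k, Sum.inl k ∈ univ.map j := fun k =>
    Finset.mem_map.2 ⟨ε.symm k, Finset.mem_univ _, by simp [j]⟩
  -- Dropping all new points drops the new relation, and no other one.
  have hcard : ∀ X : Finset (Fin #H ⊕ Fin n), #(rels T X) ≤ #(rels T (X ∩ univ.map j)) + 1 := by
    intro X
    refine (Finset.card_le_card (t := insert Sum.inr (rels T (X ∩ univ.map j))) ?_).trans
      (Finset.card_insert_le _ _)
    intro t ht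
    rw [mem_rels] at ht
    rcases ht.1 with rfl | ⟨u, hu, rfl⟩
    · exact Finset.mem_insert_self _ _
    · exact Finset.mem_insert_of_mem (mem_rels.2 ⟨ht.1, fun i =>
        Finset.mem_inter.2 ⟨ht.2 i, Finset.mem_map_of_mem j (Finset.mem_univ _)⟩⟩)
  have hdrop : ∀ X, predim T (X ∩ univ.map j) ≤ predim T X := by
    intro X
    rw [predim_eq, predim_eq]
    have h1 : #(X ∩ univ.map j) ≤ #X := Finset.card_le_card Finset.inter_subset_left
    by_cases hX : ∀ i : Fin n, Sum.inr i ∈ X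
    · have h2 : #(X ∩ univ.map j) < #X := by
        refine Finset.card_lt_card (Finset.ssubset_iff_subset_ne.2
          ⟨Finset.inter_subset_left, fun h => ?_⟩)
        have := h ▸ hX ⟨0, hn'⟩
        simp [j] at this
      have := hcard X
      omega
    · have h2 : rels T X ⊆ rels T (X ∩ univ.map j) := by
        intro t ht
        rw [mem_rels] at ht
        rcases ht.1 with rfl | ⟨u, hu, rfl⟩
        · exact absurd ht.2 hX
        · exact mem_rels.2 ⟨ht.1, fun i =>
            Finset.mem_inter.2 ⟨ht.2 i, Finset.mem_map_of_mem j (Finset.mem_univ _)⟩⟩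
      have := Finset.card_le_card h2
      omega
  have hT : InClass T := by
    intro X
    obtain ⟨X', -, hX'⟩ := Finset.subset_map_iff.1
      (Finset.inter_subset_right : X ∩ univ.map j ⊆ univ.map j)
    refine le_trans ?_ (hdrop X)
    rw [hX', hpre]
    exact hC _
  obtain ⟨g, hg, hgj, hgs⟩ := hS.extension H hH (Fin #H ⊕ Fin n) T hT j hj (by
    intro X hX
    exact (Finset.inter_eq_right.2 hX) ▸ hdrop X)
  let a : Fin n → N := fun i => g (Sum.inr i)
  have haS : a ∈ S := (hg Sum.inr).2 (Set.mem_insert _ _)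
  refine ⟨a, haS, ?_⟩
  have hGsub : (↑(univ.map g) : Set N) ⊆ ↑Z ∪ Set.range a ∪ ↑H := by
    intro c hc
    obtain ⟨x, -, rfl⟩ := Finset.mem_map.1 (Finset.mem_coe.1 hc)
    rcases x with k | i
    · obtain ⟨y, -, hy⟩ := Finset.mem_map.1 (hmemj k)
      exact Or.inr (by rw [← hy, hgj]; exact y.2)
    · exact Or.inl (Or.inr ⟨i, rfl⟩)
  have h1 : dim S ↑(univ.map g) ≤ dim S (↑Z ∪ Set.range a) := by
    have hfin := Z.finite_toSet.union (Set.finite_range a)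
    rw [← dim_union_eq_of_dim_eq hC hfin H.finite_toSet Set.subset_union_left hZH
      ((hH.dim_eq hC).trans eH)]
    exact dim_mono hC (hfin.union H.finite_toSet) hGsub
  rw [hgs.dim_eq hC, predim_map hg] at h1
  have h2 : predim T (univ.map j) = predim S H := by
    rw [hpre]
    congr 1
    ext; simp
  have h3 := hcard univ
  rw [Finset.univ_inter] at h3
  rw [predim_eq] at h1 h2
  have h4 : #(univ.map j) = #H := by simp
  have h5 : #(univ : Finset (Fin #H ⊕ Fin n)) = #H + n := by simp
  omega

end Generic

section Transport

variable {n : ℕ} {M N : Type*} (S : Set (Fin n → N)) (e : M ≃ N)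

/-- The structure on `M` for which the bijection `e : M ≃ N` is an isomorphism to `(N, S)`. -/
def pullback : Set (Fin n → M) :=
  {t | (fun i => e (t i)) ∈ S}

lemma predim_pullback (A : Finset M) :
    predim (pullback S e) A = predim S (A.map e.toEmbedding) :=
  (predim_map (S := pullback S e) (R := S) (g := e.toEmbedding) (fun _ => Iff.rfl) A).symm

lemma InClass.pullback (hS : InClass S) : InClass (pullback S e) := fun A =>
  predim_pullback S e A ▸ hS _

lemma dim_pullback (A : Set M) : dim (pullback S e) A = dim S (e '' A) := by
  unfold dim
  congr 1
  ext k
  constructor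
  · rintro ⟨B, hB, rfl⟩
    exact ⟨B.map e.toEmbedding, by simpa using hB, (predim_pullback S e B).symm⟩
  · rintro ⟨B, hB, rfl⟩
    refine ⟨B.map e.symm.toEmbedding, ?_, ?_⟩
    · intro x hx
      simpa using hB ⟨x, hx, rfl⟩
    · rw [predim_pullback, Finset.map_map]
      congr 1
      ext; simp

lemma image_PG_pullback (A : Set M) : e '' PG (pullback S e) A = PG S (e '' A) := by
  ext c
  constructor
  · rintro ⟨c, ⟨B, hB, h⟩, rfl⟩
    refine ⟨B.map e.toEmbedding, ?_, ?_⟩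
    · simpa using hB
    · rw [dim_pullback, dim_pullback, Set.image_insert_eq] at h
      simpa using h
  · rintro ⟨B, hB, h⟩
    refine ⟨e.symm c, ⟨B.map e.symm.toEmbedding, ?_, ?_⟩, e.apply_symm_apply c⟩
    · intro x hx
      obtain ⟨y, hy, rfl⟩ := Finset.mem_map.1 (Finset.mem_coe.1 hx)
      obtain ⟨z, hz, rfl⟩ := hB hy
      simpa using hz
    · rw [dim_pullback, dim_pullback, Set.image_insert_eq]
      simpa [Set.image_image] using h

end Transport

lemma LocallyIsomorphic.symm {M N : Type*} {c : Set M → Set M} {c' : Set N → Set N}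
    (h : LocallyIsomorphic c c') : LocallyIsomorphic c' c := by
  obtain ⟨Y, Z, hY, hZ, e, he⟩ := h
  refine ⟨Z, Y, hZ, hY, e.symm, fun A => ?_⟩
  have h1 := he (e.symm '' A)
  rw [Equiv.image_symm_image] at h1
  rw [← h1, Equiv.symm_image_image]

theorem IsGeneric.not_locallyIsomorphic_of_lt {m n : ℕ} (hm : m ≠ 0) (hmn : m < n)
    {M N : Type*} {R : Set (Fin m → M)} {S : Set (Fin n → N)} (hR : InClass R)
    (hS : IsGeneric S) : ¬ LocallyIsomorphic (PG R) (PG S) := by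
  rintro ⟨Y, Z, hY, hZ, e, he⟩
  lift Y to Finset M using hY
  lift Z to Finset N using hZ
  obtain ⟨a, ha, hlt⟩ := hS.exists_mem_le_dim (by omega) Z
  have hZ' : e '' ↑(Z.map e.symm.toEmbedding) = (Z : Set N) := by
    simp [Set.image_image]
  refine (dim_union_range_lt_of_PG_eq hR (hS.inClass.pullback S e) hm hmn (Y := Y)
    (Z := Z.map e.symm.toEmbedding) (fun A => ?_) (a := fun i => e.symm (a i)) ?_).not_ge ?_
  · apply e.injective.image_injective
    rw [image_PG_pullback, Set.image_union, hZ']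
    exact he A
  · simpa [pullback] using ha
  · rw [dim_pullback, dim_pullback, Set.image_union, hZ', ← Set.range_comp]
    simpa [Function.comp_def] using hlt

end Predim

theorem theorem5p6 (m n : ℕ) (hm : m ≠ 0) (hn : n ≠ 0) (hmn : m ≠ n)
    {M N : Type*} (R : Set (Fin m → M)) (S : Set (Fin n → N))
    (hR : Predim.IsGeneric R) (hS : Predim.IsGeneric S) :
    ¬ Predim.LocallyIsomorphic (Predim.PG R) (Predim.PG S) := by
  rcases hmn.lt_or_gt with h | h
  · exact hS.not_locallyIsomorphic_of_lt hm h hR.inClass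
  · exact fun hiso => hR.not_locallyIsomorphic_of_lt hn h hS.inClass hiso.symm
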